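/- Let $G=(V,E)$ be a finite, simple, undirected, connected graph with $n=|V|\ge 2$ vertices and minimum degree $\delta$. Let $(X_t)_{t\ge 0}$ be the simple random walk on $G$, which moves in each step from its current vertex to a uniformly random neighbour. For vertices $u,v$ let $H(u,v)$ be the expectation of $\min\{t\ge 1: X_t=v\}$ when $X_0=u$, let $C(u,v)=H(u,v)+H(v,u)$ be the commute time, and let $\mathsf{COV}(G)$ be the maximum, over all starting vertices $s\in V$, of the expected number of steps in which the walk from $s$ visits all vertices. In the randomized broadcast (push) algorithm started at $s$, the set of informed vertices is $I_0=\{s\}$ at time $0$, and in each time step $t=1,2,\dots$ every informed vertex independently chooses a uniformly random neighbour and informs it. Let $\mathsf{RBA}(s,v)=\min\{t\ge 0: v\in I_t\}$, and let $\mathbf{E}[\mathsf{RBA}(G)]$ be the maximum over $s\in V$ of the expectation of $\min\{t\ge 0: I_t=V\}$ when $I_0=\{s\}$. Then the expectations $\mathbf{E}[\mathsf{RBA}(s,v)]$ and $\mathbf{E}[\mathsf{RBA}(G)]$ are finite, $\mathbf{E}[\mathsf{RBA}(G)]>0$, and for every pair of vertices $s\ne v$, \[ C(s,v)\;\le\;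 4\cdot\frac{|E|}{\delta}\cdot\mathbf{E}[\mathsf{RBA}(s,v)] . \] Moreover, there is an absolute constant $K$, independent of $G$, such that for every such graph \[ \mathsf{COV}(G)\;\le\; K\cdot\frac{|E|}{\delta}\cdot\log n\cdot\mathbf{E}[\mathsf{RBA}(G)], \qquad\text{equivalently}\qquad \mathcal{R}(G):=\frac{\mathsf{COV}(G)}{\mathbf{E}[\mathsf{RBA}(G)]}\;\le\; K\cdot\frac{|E|}{\delta}\cdot\log n . \] -/

import Mathlib

open MeasureTheory
open scoped ENNReal NNReal

noncomputable section

namespace CoverBroadcast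

variable {V : Type*} [Fintype V] (G : SimpleGraph V) [DecidableRel G.Adj]

/-- The uniform distribution on the neighbours of `u`. (On an isolated vertex, which does not occur
in a connected graph with at least two vertices, the convention is to stay at `u`.) -/
def neighborPMF (u : V) : PMF V :=
  if h : (G.neighborFinset u).Nonempty then PMF.uniformOfFinset (G.neighborFinset u) h
  else PMF.pure u

/-- The probability space of random choices: under this measure on `ω : ℕ → V → V`, the vertices
`ω t u` (for a time `t` and a vertex `u`) are independent, and `ω t u` is a uniformly random
neighbour of `u`. It is the vertex to which `u` would move, or send the rumor, between
time `t` and time `t + 1`. -/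
def choiceMeasure [MeasurableSpace V] : Measure (ℕ → V → V) :=
  Measure.infinitePi fun _ : ℕ => Measure.pi fun u : V => (neighborPMF G u).toMeasure

/-- The random walk started at `s`: it moves in every step from its current vertex to the neighbour
chosen there. Since the choices are fresh in every step, under `choiceMeasure G` this is the Markov
chain with transition probabilities `1 / deg u` along the edges at `u`. -/
def walk {V : Type*} (s : V) (ω : ℕ → V → V) : ℕ → V
  | 0 => s
  | t + 1 => ω t (walk s ω t)

/-- The set of informed vertices of the randomized broadcast (push) algorithm started at `s`: in
every step each informed vertex informs the neighbour it has chosen. -/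
def informed {V : Type*} (s : V) (ω : ℕ → V → V) : ℕ → Set V
  | 0 => {s}
  | t + 1 => informed s ω t ∪ ω t '' informed s ω t

/-- The least time `t` at which `p` holds, and `∞` if there is none. -/
def firstTime (p : ℕ → Prop) : ℝ≥0∞ :=
  ⨅ (t : ℕ) (_ : p t), (t : ℝ≥0∞)

variable [MeasurableSpace V]

/-- The hitting time: the expectation of `min {t ≥ 1 : X_t = v}` for the walk with `X_0 = u`. -/
def hittingTime (u v : V) : ℝ≥0∞ :=
  ∫⁻ ω, firstTime (fun t => 0 < t ∧ walk u ω t = v) ∂(choiceMeasure G)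

/-- The commute time between `u` and `v`. -/
def commuteTime (u v : V) : ℝ≥0∞ :=
  hittingTime G u v + hittingTime G v u

/-- The expected number of steps in which the walk from `s` visits all vertices. -/
def coverTimeFrom (s : V) : ℝ≥0∞ :=
  ∫⁻ ω, firstTime (fun t => ∀ v, ∃ i ≤ t, walk s ω i = v) ∂(choiceMeasure G)

/-- The cover time of `G`: the maximum over all starting vertices. -/
def coverTime : ℝ≥0∞ :=
  ⨆ s : V, coverTimeFrom G s

/-- The expected time until the broadcast from `s` has informed the vertex `v`. -/
def pushTime (s v : V) : ℝ≥0∞ :=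
  ∫⁻ ω, firstTime (fun t => v ∈ informed s ω t) ∂(choiceMeasure G)

/-- The expected time until the broadcast from `s` has informed all vertices. -/
def broadcastTimeFrom (s : V) : ℝ≥0∞ :=
  ∫⁻ ω, firstTime (fun t => informed s ω t = Set.univ) ∂(choiceMeasure G)

/-- The expected broadcast time of `G`: the maximum over all starting vertices. -/
def broadcastTime : ℝ≥0∞ :=
  ⨆ s : V, broadcastTimeFrom G s

/-- The quotient of the cover time and the expected broadcast time. -/
def coverBroadcastRatio : ℝ≥0∞ :=
  coverTime G / broadcastTime G

end CoverBroadcast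

end

/-! Let `h v` be the function with `h v v = 0` and Laplacian `deg` off `v`; it dominates the
expected time of the walk to reach `v`. Since the Laplacian sums to zero, its value at `v` is `deg v
- 2|E|`. In `f = h v - h s + const` the degrees cancel, so `f` is the voltage of a flow of strength
`2|E|` from `s` to `v`; normalized by `f v = 0` it has `f s = h v s + h s v`, which bounds the
commute time.

Follow the least value `m` of `f` on the informed set. An informed `u` lowers it by at most `(m - f
w)⁺` on choosing `w`, and chooses `w` with probability `1 / deg u ≤ 1 / δ`. Every edge from an
informed vertex to some `w` with `f w < m` carries at least `m - f w` of flow down across the level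
`m`, and at most `2|E|` crosses that level in total. So the expected drop per step is at most `2|E|
/ δ`, while `f s` must be lost before `v` is informed. This gives the first claim with 2 in place of
4 (`ofReal_le_mul_pushTime`, `ofReal_commute_le`).

Consequently `M = 2(|E|/δ) E[RBA(G)]` bounds all `h v x`. A bound of Matthews type, `COV = O(M log
n)`, then finishes the proof. It comes from a potential logarithmic in the sum of `(h v x + M) / M`
over unvisited `v` (`one_add_average_coverPotential_le`, `coverTime_le`). -/

namespace CoverBroadcast

/-! ### Processes driven by independent choices -/

section Driven

variable {S A : Type*}

/-- The process with update rule `step`, started at `z` and driven by the sequence `ω`. -/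
def run (step : S → A → S) (z : S) (ω : ℕ → A) : ℕ → S
  | 0 => z
  | t + 1 => step (run step z ω t) (ω t)

/-- The event that the process has not reached `done` up to and including time `t`. -/
def survives (step : S → A → S) (done : S → Prop) (z : S) (t : ℕ) : Set (ℕ → A) :=
  {ω | ∀ i ≤ t, ¬ done (run step z ω i)}

theorem run_succ_eq_shift (step : S → A → S) (z : S) (ω : ℕ → A) (t : ℕ) :
    run step z ω (t + 1) = run step (step z (ω 0)) (fun i => ω (i + 1)) t := by
  induction t with
  | zero => rfl
  | succ t ih => rw [run, ih]; rfl

/-- Layer-cake formula: a first time counts the `t` strictly before it. If `p` never holds, both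
sides are `∞`. -/
theorem firstTime_eq_tsum (p : ℕ → Prop) :
    firstTime p = ∑' t, {t | ∀ i ≤ t, ¬ p i}.indicator (fun _ => (1 : ℝ≥0∞)) t := by
  classical
  by_cases h : ∃ t, p t
  · have hset : {t | ∀ i ≤ t, ¬ p i} = ↑(Finset.range (Nat.find h)) := by
      ext t
      simp [Nat.lt_find_iff]
    have hsum : ∑' t, {t | ∀ i ≤ t, ¬ p i}.indicator (fun _ => (1 : ℝ≥0∞)) t = Nat.find h := by
      rw [hset, tsum_eq_sum (s := Finset.range (Nat.find h))
        (fun t ht => Set.indicator_of_notMem (by simpa using ht) _),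
        Finset.sum_indicator_subset _ (Finset.Subset.refl _)]
      simp
    rw [hsum]
    refine le_antisymm (iInf₂_le _ (Nat.find_spec h)) (le_iInf₂ fun t ht => ?_)
    exact_mod_cast Nat.find_min' h ht
  · push Not at h
    simp [firstTime, h]

theorem firstTime_le_firstTime {p q : ℕ → Prop} (h : ∀ t, q t → p t) :
    firstTime p ≤ firstTime q :=
  le_iInf₂ fun t ht => iInf₂_le t (h t ht)

theorem survives_zero (step : S → A → S) (done : S → Prop) (z : S) :
    survives step done z 0 = {_ω | ¬ done z} := by
  simp [survives, run]

theorem survives_succ (step : S → A → S) (done : S → Prop) (z : S) (t : ℕ) :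
    survives step done z (t + 1) =
      {ω | ¬ done z ∧ (fun i => ω (i + 1)) ∈ survives step done (step z (ω 0)) t} := by
  ext ω
  simp only [survives, Set.mem_ofPred_eq]
  constructor
  · intro h
    refine ⟨h 0 (by omega), fun i hi => ?_⟩
    rw [← run_succ_eq_shift]
    exact h (i + 1) (by omega)
  · rintro ⟨h0, h⟩ i hi
    cases i with
    | zero => exact h0
    | succ i =>
      rw [run_succ_eq_shift]
      exact h i (by omega)

theorem measurableSet_survives [MeasurableSpace A] [DiscreteMeasurableSpace A] [Countable A]
    [Countable S] (step : S → A → S) (done : S → Prop) (z : S) (t : ℕ) :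
    MeasurableSet (survives step done z t) := by
  let _ : MeasurableSpace S := ⊤
  have hrun : ∀ i, Measurable fun ω : ℕ → A => run step z ω i := by
    intro i
    induction i with
    | zero => exact measurable_const
    | succ i ih =>
      have h2 : Measurable fun q : S × A => step q.1 q.2 := Measurable.of_discrete
      exact h2.comp (ih.prodMk (measurable_pi_apply i))
  have hset : survives step done z t =
      ⋂ i, ⋂ (_ : i ≤ t), (fun ω => run step z ω i) ⁻¹' {x | ¬ done x} := by
    ext ω
    simp [survives]
  rw [hset]
  exact MeasurableSet.iInter fun i => MeasurableSet.iInter fun _ =>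
    hrun i (MeasurableSet.of_discrete)

/-- Prepending an independent letter to an i.i.d. sequence yields the same law. This is the source
of the Markov property at the first step. -/
theorem map_cons_infinitePi [MeasurableSpace A] (ν : Measure A) [IsProbabilityMeasure ν] :
    (ν.prod (Measure.infinitePi fun _ : ℕ => ν)).map
      (fun q : A × (ℕ → A) => fun t : ℕ => Nat.casesOn (motive := fun _ => A) t q.1 q.2) =
      Measure.infinitePi fun _ : ℕ => ν := by
  have hmeas : Measurable
      (fun q : A × (ℕ → A) => fun t : ℕ => Nat.casesOn (motive := fun _ => A) t q.1 q.2) := by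
    refine measurable_pi_lambda _ fun t => ?_
    cases t with
    | zero => exact measurable_fst
    | succ t => exact (measurable_pi_apply t).comp measurable_snd
  refine Measure.eq_infinitePi _ fun s B hB => ?_
  classical
  obtain ⟨N, hN⟩ : ∃ N, s ⊆ Finset.range (N + 1) :=
    ⟨s.sup id, fun i hi => by
      simpa [Nat.lt_succ_iff] using Finset.le_sup (f := id) hi⟩
  -- Padding with the whole space replaces `s` by the initial segment `0, …, N`, which splits into
  -- `0` and shifted indices.
  let B' : ℕ → Set A := fun i => if i ∈ s then B i else Set.univ
  have hB' : ∀ i, MeasurableSet (B' i) := fun i => by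
    by_cases hi : i ∈ s <;> simp [B', hi, hB]
  have hpre : (fun q : A × (ℕ → A) => fun t : ℕ =>
      Nat.casesOn (motive := fun _ => A) t q.1 q.2) ⁻¹' Set.pi s B =
      B' 0 ×ˢ Set.pi (Finset.range N) fun i => B' (i + 1) := by
    ext q
    simp only [Set.mem_preimage, Set.mem_pi, Set.mem_prod, Finset.mem_coe, Finset.mem_range]
    constructor
    · intro h
      refine ⟨?_, fun i _ => ?_⟩
      · by_cases h0 : 0 ∈ s
        · simpa [B', h0] using h 0 h0
        · simp [B', h0]
      · by_cases h0 : i + 1 ∈ s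
        · simpa [B', h0] using h (i + 1) h0
        · simp [B', h0]
    · rintro ⟨h0, h⟩ i hi
      cases i with
      | zero => simpa [B', hi] using h0
      | succ i =>
        have := Finset.mem_range.1 (hN hi)
        simpa [B', hi] using h i (by omega)
  have hprod : ∏ i ∈ s, ν (B i) = ∏ i ∈ Finset.range (N + 1), ν (B' i) := by
    rw [← Finset.prod_subset hN (fun i _ hi => by simp [B', hi])]
    exact Finset.prod_congr rfl fun i hi => by simp [B', hi]
  rw [Measure.map_apply hmeas (MeasurableSet.pi s.countable_toSet fun i _ => hB i), hpre,
    Measure.prod_prod, Measure.infinitePi_pi _ (fun i _ => hB' (i + 1)), hprod,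
    Finset.prod_range_succ', mul_comm]

theorem lintegral_firstTime_eq_tsum [MeasurableSpace A] [DiscreteMeasurableSpace A] [Countable A]
    [Countable S] (ν : Measure A) (step : S → A → S) (done : S → Prop) (z : S) :
    ∫⁻ ω, firstTime (fun t => done (run step z ω t)) ∂(Measure.infinitePi fun _ : ℕ => ν) =
      ∑' t, Measure.infinitePi (fun _ : ℕ => ν) (survives step done z t) := by
  simp_rw [firstTime_eq_tsum]
  have hind : ∀ (t : ℕ) (ω : ℕ → A),
      {t | ∀ i ≤ t, ¬ done (run step z ω i)}.indicator (fun _ => (1 : ℝ≥0∞)) t =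
        (survives step done z t).indicator (fun _ => 1) ω := fun t ω => rfl
  simp_rw [hind]
  rw [lintegral_tsum fun t =>
    (measurable_const.indicator (measurableSet_survives step done z t)).aemeasurable]
  simp [lintegral_indicator, measurableSet_survives]

theorem measure_survives_of_done [MeasurableSpace A] (ν : Measure A)
    (step : S → A → S) (done : S → Prop) {z : S} (hz : done z) (t : ℕ) :
    Measure.infinitePi (fun _ : ℕ => ν) (survives step done z t) = 0 := by
  have : survives step done z t = ∅ :=
    Set.eq_empty_of_forall_notMem fun ω h => h 0 (Nat.zero_le t) hz
  simp [this]

theorem measure_survives_zero [MeasurableSpace A] (ν : Measure A) [IsProbabilityMeasure ν]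
    (step : S → A → S) (done : S → Prop) {z : S} (hz : ¬ done z) :
    Measure.infinitePi (fun _ : ℕ => ν) (survives step done z 0) = 1 := by
  simp [survives_zero, hz]

section Tail

variable [MeasurableSpace A] [DiscreteMeasurableSpace A] [Countable A] [Countable S]
  (ν : Measure A) [IsProbabilityMeasure ν] (step : S → A → S) (done : S → Prop)

/-- Condition on the first choice; what remains is a fresh run from the new state. -/
theorem measure_survives_succ {z : S} (hz : ¬ done z) (t : ℕ) :
    Measure.infinitePi (fun _ : ℕ => ν) (survives step done z (t + 1)) =
      ∫⁻ a, Measure.infinitePi (fun _ : ℕ => ν) (survives step done (step z a) t) ∂ν := by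
  have hmeas : Measurable
      (fun q : A × (ℕ → A) => fun t : ℕ => Nat.casesOn (motive := fun _ => A) t q.1 q.2) := by
    refine measurable_pi_lambda _ fun t => ?_
    cases t with
    | zero => exact measurable_fst
    | succ t => exact (measurable_pi_apply t).comp measurable_snd
  conv_lhs => rw [← map_cons_infinitePi ν]
  rw [Measure.map_apply hmeas (measurableSet_survives step done z _),
    Measure.prod_apply (hmeas (measurableSet_survives step done z _))]
  refine lintegral_congr fun a => ?_
  congr 1
  ext ω
  simp [survives_succ, hz]

/-- Upper bound on an expected absorption time by a nonnegative potential which decreases by at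
least one in expectation in every step. -/
theorem lintegral_firstTime_le (Φ : S → ℝ≥0∞)
    (hΦ : ∀ z, ¬ done z → 1 + ∫⁻ a, Φ (step z a) ∂ν ≤ Φ z) (z : S) :
    ∫⁻ ω, firstTime (fun t => done (run step z ω t)) ∂(Measure.infinitePi fun _ : ℕ => ν) ≤
      Φ z := by
  rw [lintegral_firstTime_eq_tsum, ENNReal.tsum_eq_iSup_nat]
  refine iSup_le fun T => ?_
  induction T generalizing z with
  | zero => simp
  | succ T ih =>
    by_cases hz : done z
    · simp [measure_survives_of_done ν step done hz]
    · rw [Finset.sum_range_succ', add_comm, measure_survives_zero ν step done hz]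
      simp_rw [measure_survives_succ ν step done hz]
      rw [← lintegral_finsetSum _ fun i _ => Measurable.of_discrete]
      refine le_trans ?_ (hΦ z hz)
      gcongr with a
      exact ih (step z a)

/-- Lower bound on an expected absorption time by a bounded potential which vanishes at absorption
and decreases by at most `d` in expectation in every step. -/
theorem le_mul_lintegral_firstTime (g : S → ℝ≥0∞) (d C : ℝ≥0∞) (hC : C ≠ ∞)
    (hgC : ∀ z, g z ≤ C) (hdone : ∀ z, done z → g z = 0)
    (hg : ∀ z, ¬ done z → g z ≤ d + ∫⁻ a, g (step z a) ∂ν) (z : S)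
    (hfin : ∫⁻ ω, firstTime (fun t => done (run step z ω t))
      ∂(Measure.infinitePi fun _ : ℕ => ν) ≠ ∞) :
    g z ≤ d * ∫⁻ ω, firstTime (fun t => done (run step z ω t))
      ∂(Measure.infinitePi fun _ : ℕ => ν) := by
  -- Truncated at `T`, each step survived costs at most `d`, and `g ≤ C` bounds what is left if the
  -- run still survives. The last term vanishes as `T → ∞` because the series of survival
  -- probabilities converges; this is where `hfin` enters.
  have key : ∀ (T : ℕ) (z : S), g z ≤
      d * ∑ t ∈ Finset.range T, Measure.infinitePi (fun _ : ℕ => ν) (survives step done z t) +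
        C * Measure.infinitePi (fun _ : ℕ => ν) (survives step done z T) := by
    intro T
    induction T with
    | zero =>
      intro z
      by_cases hz : done z
      · simp [hdone z hz]
      · simpa [measure_survives_zero ν step done hz] using hgC z
    | succ T ih =>
      intro z
      by_cases hz : done z
      · simp [hdone z hz]
      · rw [Finset.sum_range_succ', measure_survives_zero ν step done hz]
        simp_rw [measure_survives_succ ν step done hz]
        rw [← lintegral_finsetSum _ fun i _ => Measurable.of_discrete, mul_add, mul_one,
          ← lintegral_const_mul _ Measurable.of_discrete,
          ← lintegral_const_mul _ Measurable.of_discrete, add_comm _ d, add_assoc,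
          ← lintegral_add_left Measurable.of_discrete]
        refine (hg z hz).trans ?_
        gcongr with a
        exact ih (step z a)
  rw [lintegral_firstTime_eq_tsum] at hfin ⊢
  have hlim : Filter.Tendsto (fun T =>
      d * ∑' t, Measure.infinitePi (fun _ : ℕ => ν) (survives step done z t) +
        C * Measure.infinitePi (fun _ : ℕ => ν) (survives step done z T)) Filter.atTop
      (nhds (d * ∑' t, Measure.infinitePi (fun _ : ℕ => ν) (survives step done z t) + C * 0)) :=
    tendsto_const_nhds.add (ENNReal.Tendsto.const_mul
      (ENNReal.tendsto_atTop_zero_of_tsum_ne_top hfin) (Or.inr hC))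
  rw [mul_zero, add_zero] at hlim
  refine ge_of_tendsto' hlim fun T => (key T z).trans ?_
  gcongr
  exact ENNReal.sum_le_tsum _

end Tail

end Driven

/-! ### The graph Laplacian -/

section Laplacian

variable {V : Type*} [Fintype V] (G : SimpleGraph V) [DecidableRel G.Adj]

/-- The combinatorial Laplacian as a linear map on real functions on the vertices. -/
def laplacian : (V → ℝ) →ₗ[ℝ] (V → ℝ) where
  toFun f x := ∑ w ∈ G.neighborFinset x, (f x - f w)
  map_add' f g := by
    ext x
    simp only [Pi.add_apply, ← Finset.sum_add_distrib]
    exact Finset.sum_congr rfl fun w _ => by ring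
  map_smul' c f := by
    ext x
    simp only [Pi.smul_apply, smul_eq_mul, RingHom.id_apply, Finset.mul_sum]
    exact Finset.sum_congr rfl fun w _ => by ring

theorem laplacian_apply (f : V → ℝ) (x : V) :
    laplacian G f x = ∑ w ∈ G.neighborFinset x, (f x - f w) := rfl

theorem laplacian_apply_eq_degree_mul_sub (f : V → ℝ) (x : V) :
    laplacian G f x = G.degree x * f x - ∑ w ∈ G.neighborFinset x, f w := by
  simp [laplacian_apply, Finset.sum_sub_distrib]

/-- Discrete divergence theorem: `f x - f w` is antisymmetric, so the edges inside `S` cancel and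
only the flow out of `S` remains. -/
theorem sum_laplacian_eq_sum_boundary [DecidableEq V] (f : V → ℝ) (S : Finset V) :
    ∑ x ∈ S, laplacian G f x =
      ∑ x ∈ S, ∑ w ∈ G.neighborFinset x, if w ∈ S then 0 else f x - f w := by
  have hzero : ∑ x ∈ S, ∑ w ∈ S, (if G.Adj x w then f x - f w else 0) = 0 := by
    have hanti : ∑ x ∈ S, ∑ w ∈ S, (if G.Adj x w then f x - f w else 0) =
        - ∑ x ∈ S, ∑ w ∈ S, (if G.Adj x w then f x - f w else 0) := by
      conv_lhs => rw [Finset.sum_comm]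
      simp_rw [← Finset.sum_neg_distrib]
      refine Finset.sum_congr rfl fun x _ => Finset.sum_congr rfl fun w _ => ?_
      simp only [G.adj_comm w x]
      split_ifs <;> ring
    linarith
  have hsplit : ∀ x, laplacian G f x =
      (∑ w ∈ G.neighborFinset x, if w ∈ S then 0 else f x - f w) +
        ∑ w ∈ S, (if G.Adj x w then f x - f w else 0) := by
    intro x
    have h2 : ∑ w ∈ S, (if G.Adj x w then f x - f w else 0) =
        ∑ w ∈ G.neighborFinset x, if w ∈ S then f x - f w else 0 := by
      rw [← Finset.sum_filter, ← Finset.sum_filter]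
      refine Finset.sum_congr ?_ fun _ _ => rfl
      ext w
      simp [and_comm]
    rw [h2, ← Finset.sum_add_distrib, laplacian_apply]
    exact Finset.sum_congr rfl fun w _ => by split_ifs <;> simp
  simp_rw [hsplit]
  rw [Finset.sum_add_distrib, hzero, add_zero]

theorem sum_laplacian (f : V → ℝ) : ∑ x, laplacian G f x = 0 := by
  classical
  simp [sum_laplacian_eq_sum_boundary]

/-! ### Minimum principle, Dirichlet problem and hitting potentials. -/

variable {G}

/-- The minimum principle: a function which is superharmonic off `v` and vanishes at `v` is
nonnegative. -/
theorem nonneg_of_laplacian_nonneg (hG : G.Connected) (v : V) {f : V → ℝ} (hv : f v = 0)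
    (hf : ∀ x, x ≠ v → 0 ≤ laplacian G f x) (x : V) : 0 ≤ f x := by
  have : Nonempty V := ⟨v⟩
  obtain ⟨m, hm⟩ := Finite.exists_min f
  -- At a minimizer other than `v`, superharmonicity forces all neighbours to be minimizers too, so
  -- the minimum spreads along a path until it reaches `v`.
  have hstep : ∀ a b, G.Adj a b → f m = f a → f m = f b ∨ f m = f v := by
    intro a b hab ha
    by_cases hav : a = v
    · right; rw [ha, hav]
    · left
      have hle : ∀ w ∈ G.neighborFinset a, f a - f w ≤ 0 := fun w _ => by
        have := hm w; linarith
      have hsum : ∑ w ∈ G.neighborFinset a, (f a - f w) = 0 :=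
        le_antisymm (Finset.sum_nonpos hle) (hf a hav)
      have := (Finset.sum_eq_zero_iff_of_nonpos hle).1 hsum b (by simpa using hab)
      linarith
  have hwalk : ∀ a b, G.Walk a b → f m = f a → f m = f b ∨ f m = f v := by
    intro a b p
    induction p with
    | nil => exact Or.inl
    | cons h _ ih => exact fun ha => (hstep _ _ h ha).elim ih Or.inr
  have hmv : f m = f v := by
    obtain ⟨p⟩ := hG.preconnected m v
    exact (hwalk m v p rfl).elim id id
  have := hm x
  linarith

/-- The minimum principle for `f` and `-f` gives uniqueness; in finite dimension, injectivity gives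
existence. -/
theorem exists_laplacian_eq_off (hG : G.Connected) (v : V) (b : V → ℝ) :
    ∃ f : V → ℝ, f v = 0 ∧ ∀ x, x ≠ v → laplacian G f x = b x := by
  classical
  let D : (V → ℝ) →ₗ[ℝ] (V → ℝ) :=
    { toFun := fun f x => if x = v then f v else laplacian G f x
      map_add' := fun f g => by ext x; by_cases h : x = v <;> simp [h]
      map_smul' := fun c f => by ext x; by_cases h : x = v <;> simp [h] }
  have hD : ∀ f x, D f x = if x = v then f v else laplacian G f x := fun _ _ => rfl
  have hinj : Function.Injective D := by
    refine (injective_iff_map_eq_zero D).2 fun f hf => ?_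
    have hv : f v = 0 := by simpa [hD] using congrFun hf v
    have hl : ∀ x, x ≠ v → laplacian G f x = 0 := fun x hx => by
      simpa [hD, hx] using congrFun hf x
    ext x
    have h1 := nonneg_of_laplacian_nonneg hG v hv (fun x hx => (hl x hx).ge) x
    have h2 := nonneg_of_laplacian_nonneg hG v (f := -f) (by simp [hv])
      (fun x hx => by simp [hl x hx]) x
    simp only [Pi.neg_apply] at h2
    simp only [Pi.zero_apply]
    linarith
  obtain ⟨f, hf⟩ := LinearMap.injective_iff_surjective.1 hinj fun x => if x = v then 0 else b x
  refine ⟨f, by simpa [hD] using congrFun hf v, fun x hx => ?_⟩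
  simpa [hD, hx] using congrFun hf x

variable (G) in
/-- `h` satisfies the first-step equations of the expected time to reach `v`. -/
def IsHittingPotential (v : V) (h : V → ℝ) : Prop :=
  h v = 0 ∧ ∀ x, x ≠ v → laplacian G h x = G.degree x

theorem exists_isHittingPotential (hG : G.Connected) :
    ∃ h : V → V → ℝ, ∀ v, IsHittingPotential G v (h v) := by
  choose h hh using fun v => exists_laplacian_eq_off hG v fun x => (G.degree x : ℝ)
  exact ⟨h, hh⟩

namespace IsHittingPotential

theorem nonneg (hG : G.Connected) {v : V} {h : V → ℝ} (hh : IsHittingPotential G v h) (x : V) :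
    0 ≤ h x :=
  nonneg_of_laplacian_nonneg hG v hh.1 (fun x hx => by rw [hh.2 x hx]; positivity) x

/-- The value at `v` is forced by the zero sum of the Laplacian and the handshake lemma. -/
theorem laplacian_eq [DecidableEq V] {v : V} {h : V → ℝ} (hh : IsHittingPotential G v h) (x : V) :
    laplacian G h x = G.degree x - if x = v then 2 * (G.edgeFinset.card : ℝ) else 0 := by
  by_cases hx : x = v
  · subst hx
    have hsum := sum_laplacian G h
    have hdeg : ∑ y, (G.degree y : ℝ) = 2 * G.edgeFinset.card := by
      exact_mod_cast G.sum_degrees_eq_twice_card_edges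
    rw [← Finset.add_sum_erase _ _ (Finset.mem_univ x)] at hsum hdeg
    rw [Finset.sum_congr rfl fun y hy => hh.2 y (Finset.ne_of_mem_erase hy)] at hsum
    simp only [if_true]
    linarith
  · simp [hx, hh.2 x hx]

end IsHittingPotential

/-- If `f` carries a flow of strength `q` from `s` to `v`, then at most `q` flows from vertices
above the level `c` to the part of the range below `c`. -/
theorem sum_max_sub_le_of_laplacian_le [DecidableEq V] {f : V → ℝ} {s v : V} {q : ℝ} (hq : 0 ≤ q)
    (hf : ∀ x, laplacian G f x = (if x = s then q else 0) - if x = v then q else 0)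
    (c : ℝ) (I : Finset V) (hI : ∀ u ∈ I, c ≤ f u) :
    ∑ u ∈ I, ∑ w ∈ G.neighborFinset u, max (c - f w) 0 ≤ q := by
  classical
  -- Enlarge `I` to the full superlevel set. For `u ∈ S` and `w ∉ S` the flow `f u - f w` is at
  -- least `c - f w`, and the net flow out of `S` is at most the source strength `q`.
  let S : Finset V := Finset.univ.filter fun x => c ≤ f x
  have hS : ∀ x, x ∈ S ↔ c ≤ f x := fun x => by simp [S]
  calc ∑ u ∈ I, ∑ w ∈ G.neighborFinset u, max (c - f w) 0
      ≤ ∑ u ∈ S, ∑ w ∈ G.neighborFinset u, max (c - f w) 0 :=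
        Finset.sum_le_sum_of_subset_of_nonneg (fun u hu => (hS u).2 (hI u hu))
          fun u _ _ => Finset.sum_nonneg fun w _ => le_max_right _ _
    _ ≤ ∑ u ∈ S, ∑ w ∈ G.neighborFinset u, if w ∈ S then 0 else f u - f w := by
        refine Finset.sum_le_sum fun u hu => Finset.sum_le_sum fun w _ => ?_
        have hu' := (hS u).1 hu
        by_cases hw : w ∈ S
        · simpa [hw] using (hS w).1 hw
        · have hw' : f w < c := not_le.1 fun h => hw ((hS w).2 h)
          simp only [hw, if_false]
          exact max_le (by linarith) (by linarith)
    _ = ∑ x ∈ S, laplacian G f x := (sum_laplacian_eq_sum_boundary G f S).symm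
    _ ≤ q := by
        simp_rw [hf]
        rw [Finset.sum_sub_distrib, Finset.sum_ite_eq', Finset.sum_ite_eq']
        split_ifs <;> linarith

end Laplacian

/-! ### Expected times of the walk and of the broadcast -/

section Paths

variable {V : Type*}

theorem walk_eq_run (s : V) (ω : ℕ → V → V) (t : ℕ) :
    walk s ω t = run (fun x a => a x) s ω t := by
  induction t with
  | zero => rfl
  | succ t ih => rw [walk, run, ih]

theorem informed_eq_run (s : V) (ω : ℕ → V → V) (t : ℕ) :
    informed s ω t = run (fun I a => I ∪ a '' I) {s} ω t := by
  induction t with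
  | zero => rfl
  | succ t ih => rw [informed, run, ih]

/-- Walk and broadcast read the same choices `ω`, so the rumor always travels along with the walk.
This coupling yields finiteness of the broadcast times. -/
theorem walk_mem_informed (s : V) (ω : ℕ → V → V) {i t : ℕ} (hit : i ≤ t) :
    walk s ω i ∈ informed s ω t := by
  induction t, hit using Nat.le_induction with
  | base =>
    induction i with
    | zero => exact rfl
    | succ i ih => exact Or.inr ⟨_, ih, rfl⟩
  | succ t _ ih => exact Or.inl ih

/-- In a single step of the broadcast, the least value of `f` on the informed set decreases by at
most the sum of the decreases along the chosen edges. -/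
theorem min_iInf_le_add_sum (f : V → ℝ≥0∞) (C : ℝ≥0∞) (I : Finset V) (a : V → V) :
    min C (⨅ u ∈ (I : Set V), f u) ≤ min C (⨅ u ∈ (I ∪ a '' I : Set V), f u) +
      ∑ u ∈ I, (min C (⨅ u ∈ (I : Set V), f u) - f (a u)) := by
  set m := min C (⨅ u ∈ (I : Set V), f u) with hm
  rw [← tsub_le_iff_right]
  refine le_min (tsub_le_self.trans (min_le_left _ _)) (le_iInf₂ fun u hu => ?_)
  rcases hu with hu | ⟨w, hw, rfl⟩
  · exact tsub_le_self.trans ((min_le_right _ _).trans (iInf₂_le u hu))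
  · have hle : m - f (a w) ≤ ∑ u ∈ I, (m - f (a u)) :=
      Finset.single_le_sum (f := fun u => m - f (a u)) (fun _ _ => zero_le) hw
    rw [tsub_le_iff_right]
    exact le_add_tsub.trans (by gcongr)

end Paths

section Times

variable {V : Type*} [Fintype V] [MeasurableSpace V] {G : SimpleGraph V} [DecidableRel G.Adj]

variable (G) in
/-- The joint distribution of the choices of all vertices in a single step. -/
noncomputable def stepMeasure : Measure (V → V) :=
  Measure.pi fun u : V => (neighborPMF G u).toMeasure

instance : IsProbabilityMeasure (stepMeasure G) := by
  unfold stepMeasure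
  infer_instance

instance : IsProbabilityMeasure (choiceMeasure G) := by
  unfold choiceMeasure
  infer_instance

theorem choiceMeasure_eq : choiceMeasure G = Measure.infinitePi fun _ : ℕ => stepMeasure G := rfl

theorem hittingTime_eq {s v : V} (hsv : s ≠ v) :
    hittingTime G s v = ∫⁻ ω, firstTime (fun t => walk s ω t = v) ∂(choiceMeasure G) := by
  refine lintegral_congr fun ω => ?_
  congr 1
  ext t
  refine ⟨fun h => h.2, fun h => ⟨Nat.pos_of_ne_zero fun h0 => hsv ?_, h⟩⟩
  rwa [h0] at h

theorem pushTime_le_hittingTime (s v : V) : pushTime G s v ≤ hittingTime G s v :=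
  lintegral_mono fun ω => firstTime_le_firstTime fun _ ht =>
    ht.2 ▸ walk_mem_informed s ω le_rfl

theorem broadcastTime_le_coverTime : broadcastTime G ≤ coverTime G :=
  iSup_mono fun s => lintegral_mono fun ω => firstTime_le_firstTime fun t ht =>
    Set.eq_univ_of_forall fun v => by
      obtain ⟨i, hi, rfl⟩ := ht v
      exact walk_mem_informed s ω hi

theorem pushTime_le_broadcastTime (s v : V) : pushTime G s v ≤ broadcastTime G :=
  le_trans (lintegral_mono fun ω => firstTime_le_firstTime fun t ht => by rw [ht]; trivial)
    (le_iSup (broadcastTimeFrom G) s)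

theorem one_le_broadcastTime [Nontrivial V] : 1 ≤ broadcastTime G := by
  obtain ⟨s, v, hsv⟩ := exists_pair_ne V
  refine le_trans ?_ (le_iSup (broadcastTimeFrom G) s)
  calc (1 : ℝ≥0∞) = ∫⁻ _ω, 1 ∂(choiceMeasure G) := by simp
    _ ≤ _ := lintegral_mono fun ω => le_iInf₂ fun t ht => by
      rcases Nat.eq_zero_or_pos t with rfl | h
      · have : v ∈ informed s ω 0 := by rw [ht]; trivial
        exact absurd this hsv.symm
      · exact_mod_cast h

variable [DiscreteMeasurableSpace V]

theorem lintegral_stepMeasure_eval {u : V} (hu : 0 < G.degree u) (F : V → ℝ≥0∞) :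
    ∫⁻ a, F (a u) ∂(stepMeasure G) =
      (G.degree u : ℝ≥0∞)⁻¹ * ∑ w ∈ G.neighborFinset u, F w := by
  classical
  have hne : (G.neighborFinset u).Nonempty := by
    rw [← Finset.card_pos]; simpa using hu
  have hmp := (measurePreserving_eval (fun u : V => (neighborPMF G u).toMeasure) u)
  have h1 : ∫⁻ a, F (a u) ∂(stepMeasure G) = ∫⁻ w, F w ∂(neighborPMF G u).toMeasure :=
    hmp.lintegral_comp (f := F) Measurable.of_discrete
  rw [h1, lintegral_fintype, Finset.mul_sum,
    ← Finset.sum_subset (Finset.subset_univ (G.neighborFinset u))]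
  · refine Finset.sum_congr rfl fun w hw => ?_
    rw [PMF.toMeasure_apply_singleton _ _ (measurableSet_singleton w), neighborPMF, dif_pos hne,
      PMF.uniformOfFinset_apply_of_mem hne hw, G.card_neighborFinset_eq_degree, mul_comm]
  · intro w _ hw
    rw [PMF.toMeasure_apply_singleton _ _ (measurableSet_singleton w), neighborPMF, dif_pos hne,
      PMF.uniformOfFinset_apply_of_notMem hne hw, mul_zero]

theorem lintegral_stepMeasure_eval_ofReal {u : V} (hu : 0 < G.degree u) {F : V → ℝ}
    (hF : ∀ w, 0 ≤ F w) :
    ∫⁻ a, ENNReal.ofReal (F (a u)) ∂(stepMeasure G) =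
      ENNReal.ofReal ((G.degree u : ℝ)⁻¹ * ∑ w ∈ G.neighborFinset u, F w) := by
  rw [lintegral_stepMeasure_eval hu (fun w => ENNReal.ofReal (F w)),
    ENNReal.ofReal_mul (by positivity), ENNReal.ofReal_inv_of_pos (by exact_mod_cast hu),
    ENNReal.ofReal_natCast, ENNReal.ofReal_sum_of_nonneg fun w _ => hF w]

/-- The potential drops by exactly one per step in expectation. Only the upper bound is needed, so
equality is not proved. -/
theorem hittingTime_le [Nontrivial V] (hG : G.Connected) {s v : V} (hsv : s ≠ v) {h : V → ℝ}
    (hh : IsHittingPotential G v h) : hittingTime G s v ≤ ENNReal.ofReal (h s) := by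
  rw [hittingTime_eq hsv, choiceMeasure_eq]
  simp_rw [walk_eq_run]
  refine lintegral_firstTime_le (stepMeasure G) (fun x (a : V → V) => a x) (fun x => x = v)
    (fun x => ENNReal.ofReal (h x)) (fun x hx => ?_) s
  have hdeg : 0 < G.degree x := hG.preconnected.degree_pos_of_nontrivial x
  rw [lintegral_stepMeasure_eval_ofReal hdeg (hh.nonneg hG), ← ENNReal.ofReal_one,
    ← ENNReal.ofReal_add zero_le_one
      (mul_nonneg (by positivity) (Finset.sum_nonneg fun w _ => hh.nonneg hG w))]
  refine ENNReal.ofReal_le_ofReal (le_of_eq ?_)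
  have hl := hh.2 x hx
  rw [laplacian_apply_eq_degree_mul_sub] at hl
  have hd : (G.degree x : ℝ) ≠ 0 := by exact_mod_cast hdeg.ne'
  field_simp
  linarith

theorem pushTime_lt_top (hG : G.Connected) {s v : V} (hsv : s ≠ v) : pushTime G s v < ∞ := by
  have : Nontrivial V := ⟨s, v, hsv⟩
  obtain ⟨h, hh⟩ := exists_isHittingPotential hG
  exact ((pushTime_le_hittingTime s v).trans (hittingTime_le hG hsv (hh v))).trans_lt
    ENNReal.ofReal_lt_top

/-- The key inequality: a potential carrying a flow of strength `q` from `s` to `v` drops along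
the broadcast by at most `q / δ` per step in expectation. -/
theorem ofReal_le_mul_pushTime [DecidableEq V] (hG : G.Connected) {s v : V} (hsv : s ≠ v)
    {f : V → ℝ} {q : ℝ} (hq : 0 ≤ q) (hf0 : ∀ x, 0 ≤ f x) (hfv : f v = 0)
    (hf : ∀ x, laplacian G f x = (if x = s then q else 0) - if x = v then q else 0) :
    ENNReal.ofReal (f s) ≤
      ENNReal.ofReal q / (G.minDegree : ℝ≥0∞) * pushTime G s v := by
  classical
  have : Nontrivial V := ⟨s, v, hsv⟩
  have hdeg : ∀ x, 0 < G.degree x :=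
    fun x => hG.preconnected.degree_pos_of_nontrivial x
  -- The cap at `f s` makes `g` bounded and finite even on the empty set, where the infimum is `∞`;
  -- it does not change the value at `{s}`.
  let g : Set V → ℝ≥0∞ := fun I =>
    min (ENNReal.ofReal (f s)) (⨅ u ∈ I, ENNReal.ofReal (f u))
  have hfin := (pushTime_lt_top hG hsv).ne
  have hgs : g {s} = ENNReal.ofReal (f s) := by simp [g]
  rw [← hgs]
  have hpush : pushTime G s v = ∫⁻ ω, firstTime (fun t =>
      v ∈ run (fun (I : Set V) (a : V → V) => I ∪ a '' I) {s} ω t)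
        ∂(Measure.infinitePi fun _ : ℕ => stepMeasure G) := by
    simp_rw [← informed_eq_run]
    rfl
  rw [hpush] at hfin ⊢
  refine le_mul_lintegral_firstTime (stepMeasure G) (fun (I : Set V) (a : V → V) => I ∪ a '' I)
    (fun I => v ∈ I) g _ (ENNReal.ofReal (f s)) ENNReal.ofReal_ne_top (fun I => min_le_left _ _)
    (fun I hI => ?_) (fun I _ => ?_) {s} hfin
  · refine le_antisymm ((min_le_right _ _).trans ((iInf₂_le v hI).trans ?_)) zero_le
    simp [hfv]
  · set m := g I with hm
    have hm_top : m ≠ ∞ := ne_top_of_le_ne_top ENNReal.ofReal_ne_top (min_le_left _ _)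
    have hmI : ∀ u ∈ I.toFinset, m.toReal ≤ f u := fun u hu => by
      refine ENNReal.toReal_le_of_le_ofReal (hf0 u) ((min_le_right _ _).trans (iInf₂_le u ?_))
      simpa using hu
    calc m ≤ ∫⁻ a, (g (I ∪ a '' I) + ∑ u ∈ I.toFinset, (m - ENNReal.ofReal (f (a u))))
          ∂(stepMeasure G) := by
          calc m = ∫⁻ _a, m ∂(stepMeasure G) := by simp
            _ ≤ _ := lintegral_mono fun a => by
              have hmin := min_iInf_le_add_sum (fun u => ENNReal.ofReal (f u))
                (ENNReal.ofReal (f s)) I.toFinset a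
              rwa [Set.coe_toFinset] at hmin
      _ = ∑ u ∈ I.toFinset, (G.degree u : ℝ≥0∞)⁻¹ *
            ∑ w ∈ G.neighborFinset u, (m - ENNReal.ofReal (f w)) +
          ∫⁻ a, g (I ∪ a '' I) ∂(stepMeasure G) := by
          rw [lintegral_add_left Measurable.of_discrete,
            lintegral_finsetSum _ fun _ _ => Measurable.of_discrete, add_comm]
          congr 1
          exact Finset.sum_congr rfl fun u _ =>
            lintegral_stepMeasure_eval (hdeg u) fun w => m - ENNReal.ofReal (f w)
      _ ≤ _ := by
          gcongr
          calc _ ≤ ∑ u ∈ I.toFinset, (G.minDegree : ℝ≥0∞)⁻¹ *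
                  ∑ w ∈ G.neighborFinset u, (m - ENNReal.ofReal (f w)) := by
                gcongr with u
                exact G.minDegree_le_degree u
            _ = (∑ u ∈ I.toFinset, ∑ w ∈ G.neighborFinset u,
                  ENNReal.ofReal (max (m.toReal - f w) 0)) / (G.minDegree : ℝ≥0∞) := by
                rw [← Finset.mul_sum, mul_comm, div_eq_mul_inv]
                congr 1
                refine Finset.sum_congr rfl fun u _ => Finset.sum_congr rfl fun w _ => ?_
                rw [ENNReal.ofReal_max, ENNReal.ofReal_zero, max_eq_left zero_le,
                  ENNReal.ofReal_sub _ (hf0 w), ENNReal.ofReal_toReal hm_top]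
            _ ≤ _ := by
                gcongr
                have hnn : ∀ u, ∀ w ∈ G.neighborFinset u, 0 ≤ max (m.toReal - f w) 0 :=
                  fun _ _ _ => le_max_right _ _
                simp_rw [← fun u => ENNReal.ofReal_sum_of_nonneg (hnn u)]
                rw [← ENNReal.ofReal_sum_of_nonneg fun u _ => Finset.sum_nonneg (hnn u)]
                exact ENNReal.ofReal_le_ofReal
                  (sum_max_sub_le_of_laplacian_le hq hf m.toReal I.toFinset hmI)

theorem ofReal_commute_le [DecidableEq V] (hG : G.Connected) {s v : V} (hsv : s ≠ v)
    {hs hv : V → ℝ} (hhs : IsHittingPotential G s hs) (hhv : IsHittingPotential G v hv) :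
    ENNReal.ofReal (hv s + hs v) ≤
      2 * ((G.edgeFinset.card : ℝ≥0∞) / (G.minDegree : ℝ≥0∞)) * pushTime G s v := by
  let q : ℝ := 2 * (G.edgeFinset.card : ℝ)
  have hq : 0 ≤ q := by positivity
  -- The constant `hs v` normalizes `f v = 0`, and `f s` becomes the sum of the two hitting
  -- potentials.
  let f : V → ℝ := fun x => hv x - hs x + hs v
  have hfv : f v = 0 := by simp [f, hhv.1]
  have hf : ∀ x, laplacian G f x = (if x = s then q else 0) - if x = v then q else 0 := by
    intro x
    have hsub : laplacian G f x = laplacian G hv x - laplacian G hs x := by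
      simp only [laplacian_apply, ← Finset.sum_sub_distrib]
      exact Finset.sum_congr rfl fun w _ => by simp only [f]; ring
    rw [hsub, hhv.laplacian_eq, hhs.laplacian_eq]
    ring
  have hf0 : ∀ x, 0 ≤ f x := nonneg_of_laplacian_nonneg hG v hfv fun x hx => by
    rw [hf, if_neg hx]
    split_ifs <;> simp [hq]
  have hfs : f s = hv s + hs v := by simp [f, hhs.1]
  have key := ofReal_le_mul_pushTime hG hsv hq hf0 hfv hf
  rw [hfs] at key
  have hqE : ENNReal.ofReal q = 2 * (G.edgeFinset.card : ℝ≥0∞) := by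
    rw [ENNReal.ofReal_mul zero_le_two, ENNReal.ofReal_natCast, ENNReal.ofReal_ofNat]
  rwa [hqE, mul_div_assoc] at key

theorem commuteTime_le [DecidableEq V] (hG : G.Connected) {s v : V} (hsv : s ≠ v) :
    commuteTime G s v ≤
      2 * ((G.edgeFinset.card : ℝ≥0∞) / (G.minDegree : ℝ≥0∞)) * pushTime G s v := by
  have : Nontrivial V := ⟨s, v, hsv⟩
  obtain ⟨h, hh⟩ := exists_isHittingPotential hG
  refine le_trans ?_ (ofReal_commute_le hG hsv (hh s) (hh v))
  rw [ENNReal.ofReal_add ((hh v).nonneg hG s) ((hh s).nonneg hG v)]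
  exact add_le_add (hittingTime_le hG hsv (hh v)) (hittingTime_le hG hsv.symm (hh s))

end Times

/-! ### The cover time -/

section Cover

variable {V : Type*} {h : V → V → ℝ} {M : ℝ}

/-- The total normalized potential of the vertices in `U`, seen from `x`. -/
noncomputable def totalPotential (h : V → V → ℝ) (M : ℝ) (x : V) (U : Finset V) : ℝ :=
  ∑ v ∈ U, (h v x + M) / M

theorem card_le_totalPotential (hM : 0 < M) (hnn : ∀ v x, 0 ≤ h v x) (x : V) (U : Finset V) :
    (U.card : ℝ) ≤ totalPotential h M x U := by
  have hle := Finset.card_nsmul_le_sum U (fun v => (h v x + M) / M) 1 fun v _ => by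
    rw [le_div_iff₀ hM]
    linarith [hnn v x]
  simpa [totalPotential] using hle

theorem one_le_totalPotential (hM : 0 < M) (hnn : ∀ v x, 0 ≤ h v x) (x : V) {U : Finset V}
    (hU : U ≠ ∅) : 1 ≤ totalPotential h M x U := by
  refine le_trans ?_ (card_le_totalPotential hM hnn x U)
  exact_mod_cast Finset.card_pos.2 (Finset.nonempty_iff_ne_empty.2 hU)

theorem totalPotential_le (hM : 0 < M) (hle : ∀ v x, h v x ≤ M) (x : V) (U : Finset V) :
    totalPotential h M x U ≤ 2 * U.card := by
  have := Finset.sum_le_card_nsmul U (fun v => (h v x + M) / M) 2 fun v _ => by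
    rw [div_le_iff₀ hM]
    linarith [hle v x]
  simpa [totalPotential, mul_comm] using this

/-- Each summand drops by `1 / M` on average and is at most 2, so its relative drop is at least `1 /
(2 * M)`. -/
theorem average_totalPotential_le [Fintype V] [Nontrivial V] {G : SimpleGraph V}
    [DecidableRel G.Adj] (hG : G.Connected)
    (hh : ∀ v, IsHittingPotential G v (h v)) (hM : 0 < M) (hle : ∀ v x, h v x ≤ M) (x : V)
    {U : Finset V} (hx : x ∉ U) :
    (G.degree x : ℝ)⁻¹ * ∑ w ∈ G.neighborFinset x, totalPotential h M w U ≤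
      (1 - 1 / (2 * M)) * totalPotential h M x U := by
  have hd : (0 : ℝ) < G.degree x := by
    exact_mod_cast hG.preconnected.degree_pos_of_nontrivial x
  unfold totalPotential
  rw [Finset.sum_comm, Finset.mul_sum, Finset.mul_sum]
  refine Finset.sum_le_sum fun v hv => ?_
  have hl := (hh v).2 x fun hxv => hx (hxv ▸ hv)
  rw [laplacian_apply_eq_degree_mul_sub] at hl
  have hsum : ∑ w ∈ G.neighborFinset x, h v w = G.degree x * h v x - G.degree x := by linarith
  rw [← Finset.sum_div, Finset.sum_add_distrib, hsum, Finset.sum_const,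
    G.card_neighborFinset_eq_degree, nsmul_eq_mul]
  have heq : (G.degree x : ℝ)⁻¹ *
      ((G.degree x * h v x - G.degree x + G.degree x * M) / M) = (h v x + M - 1) / M := by
    field_simp
    ring
  have heq2 : (1 - 1 / (2 * M)) * ((h v x + M) / M) =
      (h v x + M - (h v x + M) / (2 * M)) / M := by
    field_simp
  rw [heq, heq2]
  have : (h v x + M) / (2 * M) ≤ 1 := by
    rw [div_le_one (by positivity)]
    linarith [hle v x]
  gcongr

/-! ### The unvisited set and the logarithmic potential. -/

variable [DecidableEq V]

theorem run_erase_eq (s : V) (ω : ℕ → V → V) (t : ℕ) (U : Finset V) :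
    (run (fun (z : V × Finset V) (a : V → V) => (a z.1, z.2.erase z.1)) (s, U) ω t).1 =
        walk s ω t ∧
      ∀ v, v ∈ (run (fun (z : V × Finset V) (a : V → V) => (a z.1, z.2.erase z.1)) (s, U) ω t).2 ↔
        v ∈ U ∧ ∀ i < t, walk s ω i ≠ v := by
  induction t with
  | zero => simp [run, walk]
  | succ t ih =>
    refine ⟨by rw [run, walk, ih.1], fun v => ?_⟩
    rw [run, Finset.mem_erase, ih.1, ih.2]
    simp only [Nat.lt_succ_iff_lt_or_eq]
    constructor
    · rintro ⟨h1, h2, h3⟩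
      refine ⟨h2, fun i hi => ?_⟩
      rcases hi with hi | rfl
      · exact h3 i hi
      · exact h1.symm
    · rintro ⟨h2, h3⟩
      exact ⟨(h3 t (Or.inr rfl)).symm, h2, fun i hi => h3 i (Or.inl hi)⟩

/-- The stored set lags by one step: at time `t` it omits the vertices visited strictly before `t`,
so the current position still has to be erased. -/
theorem run_erase_eq_empty_iff [Fintype V] (s : V) (ω : ℕ → V → V) (t : ℕ) :
    ((run (fun (z : V × Finset V) (a : V → V) => (a z.1, z.2.erase z.1))
        (s, Finset.univ) ω t).2.erase
      (run (fun (z : V × Finset V) (a : V → V) => (a z.1, z.2.erase z.1))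
        (s, Finset.univ) ω t).1 = ∅) ↔ ∀ v, ∃ i ≤ t, walk s ω i = v := by
  have h := (run_erase_eq s ω (t + 1) Finset.univ).2
  simp only [run] at h
  rw [Finset.eq_empty_iff_forall_notMem]
  refine forall_congr' fun v => ?_
  rw [h v]
  simp

/-- The potential bounding the expected time to visit `U` from `x`. -/
noncomputable def coverPotential (h : V → V → ℝ) (M : ℝ) (x : V) (U : Finset V) : ℝ :=
  if U.erase x = ∅ then 0 else 2 * M * (1 + Real.log (totalPotential h M x (U.erase x)))

theorem coverPotential_nonneg (hM : 0 < M) (hnn : ∀ v x, 0 ≤ h v x) (x : V) (U : Finset V) :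
    0 ≤ coverPotential h M x U := by
  unfold coverPotential
  split_ifs with hU
  · exact le_rfl
  · have := Real.log_nonneg (one_le_totalPotential hM hnn x hU)
    positivity

/-- The concave logarithm lies below its tangent at `y`. The right side is linear in the total
potential, so it can be averaged over neighbours; it also covers the case where the potential is set
to 0. -/
theorem coverPotential_le_tangent (hM : 0 < M) (hnn : ∀ v x, 0 ≤ h v x) (x : V) (U : Finset V)
    {y : ℝ} (hy : 1 ≤ y) :
    coverPotential h M x U ≤ 2 * M * (Real.log y + totalPotential h M x U / y) := by
  have hy0 : 0 < y := by linarith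
  have hlog := Real.log_nonneg hy
  have htot : totalPotential h M x (U.erase x) ≤ totalPotential h M x U :=
    Finset.sum_le_sum_of_subset_of_nonneg (Finset.erase_subset _ _) fun v _ _ =>
      div_nonneg (by linarith [hnn v x]) hM.le
  unfold coverPotential
  split_ifs with hU
  · have : 0 ≤ totalPotential h M x U :=
      le_trans (by positivity) (card_le_totalPotential hM hnn x U)
    positivity
  · have h1 := one_le_totalPotential hM hnn x hU
    have h2 := Real.log_le_sub_one_of_pos
      (x := totalPotential h M x (U.erase x) / y) (by positivity)
    rw [Real.log_div (by positivity) hy0.ne'] at h2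
    have h3 : totalPotential h M x (U.erase x) / y ≤ totalPotential h M x U / y := by gcongr
    exact mul_le_mul_of_nonneg_left (by linarith) (by positivity)

theorem coverPotential_le [Fintype V] [Nonempty V] (hM : 0 < M) (hnn : ∀ v x, 0 ≤ h v x)
    (hle : ∀ v x, h v x ≤ M) (x : V) (U : Finset V) :
    coverPotential h M x U ≤ 2 * M * (1 + Real.log (2 * Fintype.card V)) := by
  have hn : (1 : ℝ) ≤ Fintype.card V := by exact_mod_cast Fintype.card_pos
  unfold coverPotential
  split_ifs with hU
  · have := Real.log_nonneg (x := 2 * (Fintype.card V : ℝ)) (by linarith)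
    positivity
  · have h1 := one_le_totalPotential hM hnn x hU
    gcongr
    refine (totalPotential_le hM hle x _).trans ?_
    gcongr
    exact Finset.card_le_univ _

variable [Fintype V] {G : SimpleGraph V} [DecidableRel G.Adj]

/-- Take the tangent at the current total `y`. A relative drop of `1 / (2 * M)` in the total, times
the factor `2 * M`, pays for exactly one step. -/
theorem one_add_average_coverPotential_le [Nontrivial V] (hG : G.Connected)
    (hh : ∀ v, IsHittingPotential G v (h v)) (hM : 0 < M) (hle : ∀ v x, h v x ≤ M) (x : V)
    {U : Finset V} (hU : U.erase x ≠ ∅) :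
    1 + (G.degree x : ℝ)⁻¹ * ∑ w ∈ G.neighborFinset x, coverPotential h M w (U.erase x) ≤
      coverPotential h M x U := by
  have hnn : ∀ v x, 0 ≤ h v x := fun v => (hh v).nonneg hG
  have hd : (0 : ℝ) < G.degree x := by
    exact_mod_cast hG.preconnected.degree_pos_of_nontrivial x
  set y := totalPotential h M x (U.erase x) with hy
  have hy1 : 1 ≤ y := one_le_totalPotential hM hnn x hU
  have havg := average_totalPotential_le hG hh hM hle x (Finset.notMem_erase x U)
  rw [← hy] at havg
  calc 1 + (G.degree x : ℝ)⁻¹ * ∑ w ∈ G.neighborFinset x, coverPotential h M w (U.erase x)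
      ≤ 1 + (G.degree x : ℝ)⁻¹ * ∑ w ∈ G.neighborFinset x,
          2 * M * (Real.log y + totalPotential h M w (U.erase x) / y) := by
        gcongr with w
        exact coverPotential_le_tangent hM hnn w _ hy1
    _ = 1 + 2 * M * (Real.log y + ((G.degree x : ℝ)⁻¹ *
          ∑ w ∈ G.neighborFinset x, totalPotential h M w (U.erase x)) / y) := by
        rw [← Finset.mul_sum, Finset.sum_add_distrib, ← Finset.sum_div, Finset.sum_const,
          G.card_neighborFinset_eq_degree, nsmul_eq_mul]
        field_simp
    _ ≤ 1 + 2 * M * (Real.log y + ((1 - 1 / (2 * M)) * y) / y) := by gcongr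
    _ = 2 * M * (1 + Real.log y) := by
        have : y ≠ 0 := by positivity
        field_simp
        ring
    _ = coverPotential h M x U := by rw [coverPotential, if_neg hU]

variable [MeasurableSpace V] [DiscreteMeasurableSpace V]

theorem coverTime_le [Nontrivial V] (hG : G.Connected)
    (hh : ∀ v, IsHittingPotential G v (h v)) (hM : 0 < M) (hle : ∀ v x, h v x ≤ M) :
    coverTime G ≤ ENNReal.ofReal (2 * M * (1 + Real.log (2 * Fintype.card V))) := by
  have hnn : ∀ v x, 0 ≤ h v x := fun v => (hh v).nonneg hG
  refine iSup_le fun s => ?_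
  rw [coverTimeFrom, choiceMeasure_eq]
  simp_rw [← run_erase_eq_empty_iff]
  refine (lintegral_firstTime_le (stepMeasure G)
    (fun (z : V × Finset V) (a : V → V) => (a z.1, z.2.erase z.1)) (fun z => z.2.erase z.1 = ∅)
    (fun z => ENNReal.ofReal (coverPotential h M z.1 z.2)) (fun z hz => ?_)
    (s, Finset.univ)).trans (ENNReal.ofReal_le_ofReal (coverPotential_le hM hnn hle _ _))
  have hcp := coverPotential_nonneg (h := h) hM hnn
  rw [lintegral_stepMeasure_eval_ofReal (hG.preconnected.degree_pos_of_nontrivial z.1)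
      (F := fun w => coverPotential h M w (z.2.erase z.1)) (fun w => hcp w _),
    ← ENNReal.ofReal_one, ← ENNReal.ofReal_add zero_le_one
      (mul_nonneg (by positivity) (Finset.sum_nonneg fun w _ => hcp w _))]
  exact ENNReal.ofReal_le_ofReal (one_add_average_coverPotential_le hG hh hM hle z.1 hz)

theorem coverTime_lt_top [Nontrivial V] (hG : G.Connected) : coverTime G < ∞ := by
  obtain ⟨h, hh⟩ := exists_isHittingPotential hG
  have hnn : ∀ v x, 0 ≤ h v x := fun v => (hh v).nonneg hG
  -- Any finite bound on the potentials suffices here; the summand 1 makes it positive.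
  refine (coverTime_le hG hh (M := 1 + ∑ v, ∑ x, h v x) ?_ fun v x => ?_).trans_lt
    ENNReal.ofReal_lt_top
  · have : 0 ≤ ∑ v, ∑ x, h v x :=
      Finset.sum_nonneg fun v _ => Finset.sum_nonneg fun x _ => hnn v x
    linarith
  · have h1 := Finset.single_le_sum (f := h v) (fun x _ => hnn v x) (Finset.mem_univ x)
    have h2 := Finset.single_le_sum (f := fun v => ∑ x, h v x)
      (fun v _ => Finset.sum_nonneg fun x _ => hnn v x) (Finset.mem_univ v)
    linarith

/-- For `n ≥ 2`, both `log 2 ≤ log n` and `1 ≤ 2 log 2` absorb the constants into `log n`. -/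
theorem two_mul_one_add_log_le {n : ℕ} (hn : 2 ≤ n) :
    2 * (1 + Real.log (2 * n)) ≤ 8 * Real.log n := by
  have h2 : Real.log 2 ≤ Real.log n := Real.log_le_log (by norm_num) (by exact_mod_cast hn)
  have h3 := Real.log_two_gt_d9
  rw [Real.log_mul two_ne_zero (by positivity)]
  linarith

theorem coverTime_le_mul_broadcastTime [Nontrivial V] (hG : G.Connected) :
    coverTime G ≤ 16 * ((G.edgeFinset.card : ℝ≥0∞) / (G.minDegree : ℝ≥0∞)) *
      ENNReal.ofReal (Real.log (Fintype.card V)) * broadcastTime G := by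
  obtain ⟨h, hh⟩ := exists_isHittingPotential hG
  have hnn : ∀ v x, 0 ≤ h v x := fun v => (hh v).nonneg hG
  have hmin : 0 < G.minDegree := hG.preconnected.minDegree_pos_of_nontrivial
  set r : ℝ≥0∞ := (G.edgeFinset.card : ℝ≥0∞) / (G.minDegree : ℝ≥0∞) with hr
  have hB_top : broadcastTime G ≠ ∞ :=
    (broadcastTime_le_coverTime.trans_lt (coverTime_lt_top hG)).ne
  have hr_top : r ≠ ∞ :=
    ENNReal.div_ne_top (ENNReal.natCast_ne_top _) (by exact_mod_cast hmin.ne')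
  have hr_ne : r ≠ 0 := by
    refine ENNReal.div_ne_zero.2 ⟨?_, ENNReal.natCast_ne_top _⟩
    obtain ⟨x⟩ := hG.nonempty
    have hx := hG.preconnected.degree_pos_of_nontrivial x
    have hsum := G.sum_degrees_eq_twice_card_edges
    have := Finset.single_le_sum (f := fun x => G.degree x) (fun _ _ => Nat.zero_le _)
      (Finset.mem_univ x)
    have : G.edgeFinset.card ≠ 0 := by omega
    exact_mod_cast this
  have hB_ne : broadcastTime G ≠ 0 := (zero_lt_one.trans_le one_le_broadcastTime).ne'
  set B : ℝ≥0∞ := 2 * r * broadcastTime G with hB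
  have hBt : B ≠ ∞ := ENNReal.mul_ne_top (ENNReal.mul_ne_top ENNReal.ofNat_ne_top hr_top) hB_top
  have hM : 0 < B.toReal :=
    ENNReal.toReal_pos (mul_ne_zero (mul_ne_zero two_ne_zero hr_ne) hB_ne) hBt
  -- A single hitting potential is at most the two-way sum, which the flow argument bounds by the
  -- push time and hence by the broadcast time.
  have hle : ∀ v x, h v x ≤ B.toReal := fun v x => by
    by_cases hxv : x = v
    · rw [hxv, (hh v).1]
      exact hM.le
    · rw [← ENNReal.ofReal_le_iff_le_toReal hBt]
      calc ENNReal.ofReal (h v x) ≤ ENNReal.ofReal (h v x + h x v) :=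
            ENNReal.ofReal_le_ofReal (by linarith [hnn x v])
        _ ≤ 2 * r * pushTime G x v := ofReal_commute_le hG hxv (hh x) (hh v)
        _ ≤ B := by
            rw [hB]
            gcongr
            exact pushTime_le_broadcastTime x v
  have hlog := two_mul_one_add_log_le (Fintype.one_lt_card (α := V))
  calc coverTime G
      ≤ ENNReal.ofReal (2 * B.toReal * (1 + Real.log (2 * Fintype.card V))) :=
        coverTime_le hG hh hM hle
    _ ≤ ENNReal.ofReal (B.toReal * (8 * Real.log (Fintype.card V))) := by
        refine ENNReal.ofReal_le_ofReal ?_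
        rw [mul_comm 2 B.toReal, mul_assoc]
        gcongr
    _ = 16 * r * ENNReal.ofReal (Real.log (Fintype.card V)) * broadcastTime G := by
        rw [ENNReal.ofReal_mul hM.le, ENNReal.ofReal_toReal hBt,
          ENNReal.ofReal_mul (by norm_num), ENNReal.ofReal_ofNat, hB]
        ring

end Cover

end CoverBroadcast

theorem mainTheorem1 :
    (∀ (V : Type*) [Fintype V] [DecidableEq V] [MeasurableSpace V] [DiscreteMeasurableSpace V]
        (G : SimpleGraph V) [DecidableRel G.Adj], G.Connected →
        ∀ s v : V, s ≠ v →
          CoverBroadcast.pushTime G s v < ∞ ∧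
          CoverBroadcast.commuteTime G s v ≤
            4 * ((G.edgeFinset.card : ℝ≥0∞) / (G.minDegree : ℝ≥0∞)) *
              CoverBroadcast.pushTime G s v) ∧
    (∃ C : ℝ≥0, ∀ (V : Type*) [Fintype V] [DecidableEq V] [Nontrivial V] [MeasurableSpace V]
        [DiscreteMeasurableSpace V] (G : SimpleGraph V) [DecidableRel G.Adj], G.Connected →
          0 < CoverBroadcast.broadcastTime G ∧
          CoverBroadcast.broadcastTime G < ∞ ∧
          CoverBroadcast.coverTime G ≤
            C * ((G.edgeFinset.card : ℝ≥0∞) / (G.minDegree : ℝ≥0∞)) *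
              ENNReal.ofReal (Real.log (Fintype.card V)) * CoverBroadcast.broadcastTime G ∧
          CoverBroadcast.coverBroadcastRatio G ≤
            C * ((G.edgeFinset.card : ℝ≥0∞) / (G.minDegree : ℝ≥0∞)) *
              ENNReal.ofReal (Real.log (Fintype.card V))) := by
  refine ⟨fun V _ _ _ _ G _ hG s v hsv =>
    ⟨CoverBroadcast.pushTime_lt_top hG hsv, (CoverBroadcast.commuteTime_le hG hsv).trans ?_⟩,
    16, fun V _ _ _ _ _ G _ hG => ?_⟩
  · gcongr
    norm_num
  · have hpos : 0 < CoverBroadcast.broadcastTime G :=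
      zero_lt_one.trans_le CoverBroadcast.one_le_broadcastTime
    have hfin : CoverBroadcast.broadcastTime G < ∞ :=
      CoverBroadcast.broadcastTime_le_coverTime.trans_lt (CoverBroadcast.coverTime_lt_top hG)
    have hcov := CoverBroadcast.coverTime_le_mul_broadcastTime hG
    exact ⟨hpos, hfin, hcov, ENNReal.div_le_of_le_mul hcov⟩
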